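/- Theorem. In a load balancing game on $m$ identical servers there are finitely many jobs $1,\dots,n$; job $j$ has a processing time $p_j>0$. An assignment $S$ puts every job on one of the $m$ servers; the workload of a server is the total processing time of the jobs assigned to it, and the completion time $c_j(S)$ of job $j$ is the workload of its server. The assignment $S$ is a (pure) Nash equilibrium if no single job can reduce its completion time by moving alone to another server. If a nonempty set $\Gamma$ of jobs (a coalition) jointly migrates, each member moving to a server different from its current one while all other jobs stay, so that $S$ becomes $S'$, then the improvement ratio of $j\in\Gamma$ is $c_j(S)/c_j(S')$. For $\rho\ge 1$, a Nash equilibrium $S$ is a $\rho$-approximate strong Nash equilibrium if there is no coalition with a joint migration in which the improvement ratio of every member of the coalition is greater than $\rho$. (i) For every $m\ge 3$, every Nash equilibrium of every load balancing game on $m$ identical servers is a $\tfrac54$-approximate strong Nash equilibrium. (ii) The bound is tight: for every $m\ge 3$ there are a load balancing game on $m$ identical servers, a Nash equilibrium $S$ of it, and a joint migration of a coalition in which every member has improvement ratio exactly $\tfrac54$; in particular, $S$ is not a $\rho$-approximate strong Nash equilibrium for any $1\le\rho<\tfrac54$. (iii) For $m=3$ this happens for six jobs placed on the servers in the pairs of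 lengths $(2,3)$, $(2,3)$, $(5,5)$: this is a Nash equilibrium, and when the two jobs of length $2$ move to the third server and the two jobs of length $5$ move one each to the first and second servers, each of these four jobs has improvement ratio exactly $\tfrac54$. In particular, this assignment is not a $\rho$-approximate strong Nash equilibrium for any $1\le\rho<\tfrac54$. -/

import Mathlib

/-- A load balancing game with `n` jobs: job `j` has processing time (length) `p j > 0`.
The servers are identical, so a game carries no further data; the servers `Fin m` appear as the
targets of the job assignments. -/
structure LoadBalancingGame (n : ℕ) where
  /-- the processing time of each job -/
  p : Fin n → ℝ
  p_pos : ∀ j, 0 < p j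

namespace LoadBalancingGame

variable {m n : ℕ}

/-- The workload of server `i` in the assignment `S` (which puts job `j` on server `S j`): the
total processing time of the jobs assigned to it. -/
noncomputable def workload (G : LoadBalancingGame n) (S : Fin n → Fin m) (i : Fin m) : ℝ :=
  ∑ j with S j = i, G.p j

/-- The completion time (the cost) of job `j` in `S`: the workload of the server of `j`. -/
noncomputable def completionTime (G : LoadBalancingGame n) (S : Fin n → Fin m) (j : Fin n) : ℝ :=
  G.workload S (S j)

/-- `S` is a (pure) Nash equilibrium: no job can reduce its completion time by migrating alone,
all other jobs staying where they are. -/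
def IsNash (G : LoadBalancingGame n) (S : Fin n → Fin m) : Prop :=
  ∀ (j : Fin n) (i : Fin m),
    G.completionTime S j ≤ G.completionTime (Function.update S j i) j

/-- `S'` arises from `S` by a coordinated deviation of the (nonempty) coalition `Γ`: every member
of `Γ` migrates to another server, and all other jobs stay where they are. -/
def IsDeviation (S : Fin n → Fin m) (Γ : Finset (Fin n)) (S' : Fin n → Fin m) : Prop :=
  Γ.Nonempty ∧ (∀ j ∈ Γ, S' j ≠ S j) ∧ ∀ j ∉ Γ, S' j = S j

/-- The improvement ratio of job `j` when `S` is changed into `S'`: the ratio between its cost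
before and its cost after the deviation. The denominator is positive, because it is at least the
processing time of `j`. -/
noncomputable def improvementRatio (G : LoadBalancingGame n) (S S' : Fin n → Fin m)
    (j : Fin n) : ℝ :=
  G.completionTime S j / G.completionTime S' j

/-- `S` is a `ρ`-approximate strong Nash equilibrium (meant for `1 ≤ ρ`): it is a Nash
equilibrium, and no coalition has a coordinated deviation in which the improvement ratio of each
of its members is more than `ρ`. -/
def IsApproxStrongNash (G : LoadBalancingGame n) (ρ : ℝ) (S : Fin n → Fin m) : Prop :=
  G.IsNash S ∧
    ¬ ∃ (Γ : Finset (Fin n)) (S' : Fin n → Fin m),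
      IsDeviation S Γ S' ∧ ∀ j ∈ Γ, ρ < G.improvementRatio S S' j

/-- Six jobs of lengths 2, 3, 2, 3, 5, 5. -/
noncomputable def sixJobs : LoadBalancingGame 6 where
  p := ![2, 3, 2, 3, 5, 5]
  p_pos := by
    intro j
    fin_cases j <;> norm_num

/-- The six jobs on three servers in the pairs (2, 3), (2, 3), (5, 5). -/
def sixJobsBefore : Fin 6 → Fin 3 := ![0, 0, 1, 1, 2, 2]

/-- The coalition that consists of the four jobs of lengths 2 and 5. -/
def sixJobsCoalition : Finset (Fin 6) := {0, 2, 4, 5}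

/-- The two jobs of length 2 go to the third server, and the two jobs of length 5 go one each to
the first and second servers, which gives the pairs (5, 3), (5, 3), (2, 2). -/
def sixJobsAfter : Fin 6 → Fin 3 := ![2, 0, 2, 1, 0, 1]

end LoadBalancingGame

/-!
The upper bound is a weighted counting argument. Suppose that every member of a coalition improves
by a factor of more than `5/4`. Let `ℓ` be the least workload before the deviation, write `L i` for
the workload of server `i` before it, and let every migrating job `j` carry the weight
`p j * z (L (S j))`, where `z x = 1 / x` for `x < 5/4 * ℓ` and `z x = (4/5) / x` from there on
(`loadWeight`). Let `P` and `Q` be the total lengths of the jobs that leave and that enter a given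
server. If a job enters it from a server of workload `Y`, then `Y` exceeds `5/4` of the new
workload, and `Y - ℓ ≤ Q` because in a Nash equilibrium that job has length at least `Y - ℓ`. These
two facts alone give `Q * z Y < P * z L`, where `L` is the old workload of the receiving server
(`incoming_weight_lt`). Hence at every server that receives a job less weight enters than leaves,
whereas summed over all servers the two are equal.

The bound is attained by `sixJobs`. With more than three servers, every further server gets a single
job of length `5` (`pad`); these jobs stay where they are and disturb neither the equilibrium nor
the deviation.
-/

namespace LoadBalancingGame

/-! ### Nash equilibria and deviations in terms of workloads -/

variable {m n : ℕ}

lemma completionTime_update_of_ne (G : LoadBalancingGame n) (S : Fin n → Fin m) (j : Fin n)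
    (i : Fin m) (h : i ≠ S j) :
    G.completionTime (Function.update S j i) j = G.workload S i + G.p j := by
  unfold completionTime workload
  have hs : (Finset.univ.filter fun k => Function.update S j i k = Function.update S j i j)
      = insert j (Finset.univ.filter fun k => S k = i) := by
    ext k
    by_cases hk : k = j
    · simp [hk]
    · simp [hk]
  rw [hs, Finset.sum_insert (by simpa using h.symm), add_comm]

lemma isNash_iff (G : LoadBalancingGame n) (S : Fin n → Fin m) :
    G.IsNash S ↔ ∀ j i, i ≠ S j → G.workload S (S j) ≤ G.workload S i + G.p j := by
  constructor
  · intro h j i hi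
    rw [← completionTime_update_of_ne G S j i hi]
    exact h j i
  · intro h j i
    by_cases hi : i = S j
    · rw [hi, Function.update_eq_self]
    · rw [completionTime_update_of_ne G S j i hi]
      exact h j i hi

lemma workload_nonneg (G : LoadBalancingGame n) (S : Fin n → Fin m) (i : Fin m) :
    0 ≤ G.workload S i :=
  Finset.sum_nonneg fun j _ => (G.p_pos j).le

lemma completionTime_pos (G : LoadBalancingGame n) (S : Fin n → Fin m) (j : Fin n) :
    0 < G.completionTime S j := by
  unfold completionTime workload
  exact Finset.sum_pos (fun k _ => G.p_pos k) ⟨j, by simp⟩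

lemma not_isApproxStrongNash_of_deviation {G : LoadBalancingGame n} {S S' : Fin n → Fin m}
    {Γ : Finset (Fin n)} {r ρ : ℝ} (hd : IsDeviation S Γ S')
    (hr : ∀ j ∈ Γ, G.improvementRatio S S' j = r) (hρ : ρ < r) :
    ¬ G.IsApproxStrongNash ρ S :=
  fun h => h.2 ⟨Γ, S', hd, fun j hj => by rw [hr j hj]; exact hρ⟩

/-- The part of the workload of server `i` that the jobs outside `Γ` contribute. -/
noncomputable def stayingLoad (G : LoadBalancingGame n) (S : Fin n → Fin m)
    (Γ : Finset (Fin n)) (i : Fin m) : ℝ :=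
  ∑ j with S j = i ∧ j ∉ Γ, G.p j

lemma workload_eq_staying_add (G : LoadBalancingGame n) (S : Fin n → Fin m)
    (Γ : Finset (Fin n)) (i : Fin m) :
    G.workload S i = G.stayingLoad S Γ i + ∑ j ∈ Γ with S j = i, G.p j := by
  unfold workload stayingLoad
  rw [← Finset.sum_filter_add_sum_filter_not _ (fun j => j ∉ Γ), Finset.filter_filter]
  congr 1
  refine Finset.sum_congr ?_ fun _ _ => rfl
  ext j
  simp [and_comm]

lemma stayingLoad_eq_of_isDeviation (G : LoadBalancingGame n) {S S' : Fin n → Fin m}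
    {Γ : Finset (Fin n)} (h : IsDeviation S Γ S') (i : Fin m) :
    G.stayingLoad S' Γ i = G.stayingLoad S Γ i := by
  unfold stayingLoad
  refine Finset.sum_congr ?_ fun _ _ => rfl
  ext j
  simp only [Finset.mem_filter, Finset.mem_univ, true_and, and_congr_left_iff]
  intro hj
  rw [h.2.2 j hj]

/-! ### The weight of a migrating job -/

/-- The weight per unit of length of a job that leaves a server of workload `x`, when the least
workload is `ℓ`. -/
noncomputable def loadWeight (ℓ x : ℝ) : ℝ :=
  if x < 5 / 4 * ℓ then 1 / x else 4 / 5 / x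

/-- The weight that enters a server is smaller than the weight that leaves it. Here `s`, `P` and `Q`
are the total lengths of the jobs that stay on, leave and enter the server, and `Y` is the workload
of a server from which a job enters. -/
lemma incoming_weight_lt {ℓ s P Q Y : ℝ} (hℓ : 0 < ℓ) (hs : 0 ≤ s)
    (hL : ℓ ≤ s + P) (hY : ℓ ≤ Y) (hQ : Y - ℓ ≤ Q) (himp : 5 / 4 * (s + Q) < Y) :
    Q * loadWeight ℓ Y < P * loadWeight ℓ (s + P) := by
  obtain ⟨L, rfl⟩ : ∃ L, P = L - s := ⟨s + P, by ring⟩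
  rw [add_sub_cancel] at hL ⊢
  have hY0 : 0 < Y := hℓ.trans_le hY
  have hL0 : 0 < L := hℓ.trans_le hL
  have hsY : s < 4 / 5 * Y - Q := by linarith
  have hsY' : s * Y < (4 / 5 * Y - Q) * Y := mul_lt_mul_of_pos_right hsY hY0
  unfold loadWeight
  split_ifs with h1 h2 h2
  · have key : Q * L < (L - s) * Y := by
      have h3 : ℓ * (Y - Q) ≤ L * (Y - Q) := mul_le_mul_of_nonneg_right hL (by linarith)
      have hQ0 : 0 ≤ Q := by linarith
      have h4 : 0 ≤ Y * (5 / 4 * ℓ - Y) := mul_nonneg hY0.le (by linarith)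
      have h5 : 0 ≤ Q * (Y - ℓ) := mul_nonneg hQ0 (by linarith)
      linarith
    rw [mul_one_div, mul_one_div, div_lt_div_iff₀ hY0 hL0]
    exact key
  · have key : Q * L < (L - s) * (4 / 5) * Y := by
      have h3 : L * s ≤ L * (4 / 5 * Y - Q) := mul_le_mul_of_nonneg_left hsY.le hL0.le
      have h4 : 0 < (L - 4 / 5 * Y) * (4 / 5 * Y - Q) := mul_pos (by linarith) (by linarith)
      nlinarith
    rw [mul_one_div, ← mul_div_assoc, div_lt_div_iff₀ hY0 hL0]
    exact key
  · have key : Q * (4 / 5) * L < (L - s) * Y := by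
      have h3 : ℓ * (Y - 4 / 5 * Q) ≤ L * (Y - 4 / 5 * Q) :=
        mul_le_mul_of_nonneg_right hL (by linarith)
      have h4 : 0 ≤ (Q - (Y - ℓ)) * (Y - 4 / 5 * ℓ) := mul_nonneg (by linarith) (by linarith)
      -- Equality at `Y = 2 * ℓ`, as for the jobs that leave the third server of `sixJobs`.
      have h5 : 0 ≤ (Y - 2 * ℓ) ^ 2 := sq_nonneg _
      linarith
    rw [mul_one_div, ← mul_div_assoc, div_lt_div_iff₀ hY0 hL0]
    exact key
  · have key : Q * (4 / 5) * L < (L - s) * (4 / 5) * Y := by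
      have h3 : 5 / 4 * ℓ * (Y - Q) ≤ L * (Y - Q) :=
        mul_le_mul_of_nonneg_right (by linarith) (by linarith)
      have h4 : 0 ≤ (Q - (Y - ℓ)) * (Y - 5 / 4 * ℓ) := mul_nonneg (by linarith) (by linarith)
      have h5 : 0 ≤ (Y - 5 / 2 * ℓ) ^ 2 := sq_nonneg _
      linarith
    rw [← mul_div_assoc Q, ← mul_div_assoc (L - s), div_lt_div_iff₀ hY0 hL0]
    exact key

lemma loadWeight_nonneg {ℓ x : ℝ} (hx : 0 ≤ x) : 0 ≤ loadWeight ℓ x := by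
  unfold loadWeight
  split_ifs <;> positivity

/-! ### The upper bound -/

theorem IsNash.isApproxStrongNash {G : LoadBalancingGame n} {S : Fin n → Fin m}
    (hS : G.IsNash S) : G.IsApproxStrongNash (5 / 4) S := by
  refine ⟨hS, ?_⟩
  rintro ⟨Γ, S', hd, hr⟩
  obtain ⟨j₀, hj₀⟩ := hd.1
  have : Nonempty (Fin m) := ⟨S j₀⟩
  obtain ⟨i₀, hi₀⟩ := Finite.exists_min (G.workload S)
  rw [isNash_iff] at hS
  have hL : ∀ i, G.workload S i = G.stayingLoad S Γ i + ∑ j ∈ Γ with S j = i, G.p j :=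
    G.workload_eq_staying_add S Γ
  have hL' : ∀ i, G.workload S' i = G.stayingLoad S Γ i + ∑ j ∈ Γ with S' j = i, G.p j := by
    intro i
    rw [G.workload_eq_staying_add S' Γ, G.stayingLoad_eq_of_isDeviation hd]
  have hstay : ∀ i, 0 ≤ G.stayingLoad S Γ i :=
    fun i => Finset.sum_nonneg fun j _ => (G.p_pos j).le
  have himp : ∀ j ∈ Γ, 5 / 4 * G.workload S' (S' j) < G.workload S (S j) := fun j hj =>
    (lt_div_iff₀ (G.completionTime_pos S' j)).1 (hr j hj)
  have hin : ∀ j ∈ Γ, G.p j ≤ ∑ k ∈ Γ with S' k = S' j, G.p k := fun j hj =>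
    Finset.single_le_sum (fun k _ => (G.p_pos k).le) (by simp [hj])
  have hsize : ∀ j, G.workload S (S j) - G.workload S i₀ ≤ G.p j := by
    intro j
    by_cases h : i₀ = S j
    · rw [h, sub_self]
      exact (G.p_pos j).le
    · linarith [hS j i₀ h]
  -- If some server were empty, a migrating job would have been alone on its server.
  have hℓ : 0 < G.workload S i₀ := by
    linarith [hsize j₀, hin j₀ hj₀, himp j₀ hj₀, hL' (S' j₀), hstay (S' j₀), G.p_pos j₀]
  set z := loadWeight (G.workload S i₀) with hz
  have hserver : ∀ j ∈ Γ, (∑ k ∈ Γ with S' k = S' j, G.p k) * z (G.workload S (S j)) <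
      (∑ k ∈ Γ with S k = S' j, G.p k) * z (G.workload S (S' j)) := by
    intro j hj
    have h := himp j hj
    rw [hL' (S' j)] at h
    rw [hL (S' j)]
    exact incoming_weight_lt hℓ (hstay _) (by rw [← hL]; exact hi₀ _) (hi₀ _)
      ((hsize j).trans (hin j hj)) h
  have hlt : ∀ j₁ ∈ Γ, ∑ j ∈ Γ with S' j = S' j₁, G.p j * z (G.workload S (S j)) <
      ∑ j ∈ Γ with S j = S' j₁, G.p j * z (G.workload S (S j)) := by
    intro j₁ hj₁
    have hout : ∑ j ∈ Γ with S j = S' j₁, G.p j * z (G.workload S (S j)) =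
        (∑ j ∈ Γ with S j = S' j₁, G.p j) * z (G.workload S (S' j₁)) := by
      rw [Finset.sum_mul]
      refine Finset.sum_congr rfl fun j hj => ?_
      rw [(Finset.mem_filter.1 hj).2]
    rw [hout]
    set Q := ∑ k ∈ Γ with S' k = S' j₁, G.p k with hQ
    have hQ0 : 0 < Q := (G.p_pos j₁).trans_le (hin j₁ hj₁)
    refine lt_of_mul_lt_mul_left ?_ hQ0.le
    rw [Finset.mul_sum]
    conv_rhs => rw [hQ, Finset.sum_mul]
    refine Finset.sum_lt_sum_of_nonempty ⟨j₁, by simp [hj₁]⟩ fun j hj => ?_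
    obtain ⟨hjΓ, hjS⟩ := Finset.mem_filter.1 hj
    have h := hserver j hjΓ
    rw [hjS] at h
    rw [mul_left_comm]
    exact mul_lt_mul_of_pos_left h (G.p_pos j)
  have hle : ∀ i, ∑ j ∈ Γ with S' j = i, G.p j * z (G.workload S (S j)) ≤
      ∑ j ∈ Γ with S j = i, G.p j * z (G.workload S (S j)) := by
    intro i
    by_cases h : ∃ j ∈ Γ, S' j = i
    · obtain ⟨j, hj, rfl⟩ := h
      exact (hlt j hj).le
    · rw [Finset.filter_false_of_mem fun j hj hji => h ⟨j, hj, hji⟩, Finset.sum_empty]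
      exact Finset.sum_nonneg fun j _ =>
        mul_nonneg (G.p_pos j).le (loadWeight_nonneg (G.workload_nonneg S _))
  have hsum := Finset.sum_lt_sum (fun i (_ : i ∈ Finset.univ) => hle i)
    ⟨S' j₀, Finset.mem_univ _, hlt j₀ hj₀⟩
  rw [Finset.sum_fiberwise, Finset.sum_fiberwise] at hsum
  exact lt_irrefl _ hsum

/-! ### Six jobs on three servers -/

lemma sixJobs_workload_before : sixJobs.workload sixJobsBefore = ![5, 5, 10] := by
  funext i
  rw [workload, Finset.sum_filter, Fin.sum_univ_six]
  fin_cases i <;> simp [sixJobs, sixJobsBefore] <;> norm_num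

lemma sixJobs_workload_after : sixJobs.workload sixJobsAfter = ![8, 8, 4] := by
  funext i
  rw [workload, Finset.sum_filter, Fin.sum_univ_six]
  fin_cases i <;> simp [sixJobs, sixJobsAfter] <;> norm_num

lemma sixJobs_isNash : sixJobs.IsNash sixJobsBefore := by
  rw [isNash_iff, sixJobs_workload_before]
  intro j i _
  fin_cases j <;> fin_cases i <;> simp [sixJobs, sixJobsBefore] <;> norm_num

lemma sixJobs_isDeviation : IsDeviation sixJobsBefore sixJobsCoalition sixJobsAfter := by
  unfold IsDeviation
  decide

lemma sixJobs_improvementRatio :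
    ∀ j ∈ sixJobsCoalition, sixJobs.improvementRatio sixJobsBefore sixJobsAfter j = 5 / 4 := by
  unfold improvementRatio completionTime
  rw [sixJobs_workload_before, sixJobs_workload_after]
  simp [sixJobsCoalition, sixJobsBefore, sixJobsAfter]
  norm_num

/-! ### Additional servers -/

/-- The game `G` with `k` additional jobs of length `c`. -/
noncomputable def pad (G : LoadBalancingGame n) (k : ℕ) (c : ℝ) (hc : 0 < c) :
    LoadBalancingGame (n + k) where
  p := Fin.append G.p fun _ => c
  p_pos j := by
    refine Fin.addCases (fun j => ?_) (fun j => ?_) j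
    · simpa using G.p_pos j
    · simpa using hc

/-- The assignment `S` on `k` additional servers, each of which gets one of the `k` additional
jobs. -/
def padAssignment (S : Fin n → Fin m) (k : ℕ) : Fin (n + k) → Fin (m + k) :=
  Fin.append (fun j => Fin.castAdd k (S j)) (Fin.natAdd m)

@[simp]
lemma padAssignment_castAdd (S : Fin n → Fin m) (k : ℕ) (j : Fin n) :
    padAssignment S k (Fin.castAdd k j) = Fin.castAdd k (S j) := by
  simp [padAssignment]

@[simp]
lemma padAssignment_natAdd (S : Fin n → Fin m) (k : ℕ) (j : Fin k) :
    padAssignment S k (Fin.natAdd n j) = Fin.natAdd m j := by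
  simp [padAssignment]

lemma castAdd_ne_natAdd {k : ℕ} (i : Fin m) (j : Fin k) : Fin.castAdd k i ≠ Fin.natAdd m j := by
  intro h
  have := congrArg Fin.val h
  simp at this
  omega

variable (G : LoadBalancingGame n) (k : ℕ) {c : ℝ} (hc : 0 < c)

lemma pad_workload_castAdd (S : Fin n → Fin m) (i : Fin m) :
    (G.pad k c hc).workload (padAssignment S k) (Fin.castAdd k i) = G.workload S i := by
  simp [workload, pad, Finset.sum_filter, Fin.sum_univ_add, (castAdd_ne_natAdd _ _).symm]

lemma pad_workload_natAdd (S : Fin n → Fin m) (i : Fin k) :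
    (G.pad k c hc).workload (padAssignment S k) (Fin.natAdd m i) = c := by
  simp [workload, pad, Finset.sum_filter, Fin.sum_univ_add, castAdd_ne_natAdd]

lemma pad_isNash {S : Fin n → Fin m} (hS : G.IsNash S)
    (hload : ∀ j, G.workload S (S j) ≤ c + G.p j) :
    (G.pad k c hc).IsNash (padAssignment S k) := by
  rw [isNash_iff] at hS ⊢
  intro j
  refine Fin.addCases (fun j i => ?_) (fun j i _ => ?_) j
  · rw [padAssignment_castAdd, pad_workload_castAdd]
    refine Fin.addCases (fun i hi => ?_) (fun i _ => ?_) i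
    · rw [pad_workload_castAdd]
      simpa [pad] using hS j i fun h => hi (by rw [h])
    · rw [pad_workload_natAdd]
      simpa [pad] using hload j
  · rw [padAssignment_natAdd, pad_workload_natAdd]
    simpa [pad] using (G.pad k c hc).workload_nonneg (padAssignment S k) i

lemma pad_isDeviation {S S' : Fin n → Fin m} {Γ : Finset (Fin n)} (h : IsDeviation S Γ S') :
    IsDeviation (padAssignment S k) (Γ.map (Fin.castAddEmb k)) (padAssignment S' k) := by
  obtain ⟨hne, hmove, hstay⟩ := h
  refine ⟨hne.map, ?_, fun j => ?_⟩
  · intro j hj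
    obtain ⟨j, hjΓ, rfl⟩ := Finset.mem_map.1 hj
    simpa using hmove j hjΓ
  · refine Fin.addCases (fun j hj => ?_) (fun j _ => ?_) j
    · rw [padAssignment_castAdd, padAssignment_castAdd,
        hstay j fun hjΓ => hj (Finset.mem_map.2 ⟨j, hjΓ, rfl⟩)]
    · simp

lemma pad_improvementRatio (S S' : Fin n → Fin m) (j : Fin n) :
    (G.pad k c hc).improvementRatio (padAssignment S k) (padAssignment S' k) (Fin.castAdd k j) =
      G.improvementRatio S S' j := by
  simp only [improvementRatio, completionTime, padAssignment_castAdd, pad_workload_castAdd]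

/-- The bound `5/4` is attained on any number `m ≥ 3` of servers. -/
theorem exists_isNash_improvementRatio_eq (hm : 3 ≤ m) :
    ∃ (n : ℕ) (G : LoadBalancingGame n) (S : Fin n → Fin m), G.IsNash S ∧
      ∃ (Γ : Finset (Fin n)) (S' : Fin n → Fin m),
        IsDeviation S Γ S' ∧ ∀ j ∈ Γ, G.improvementRatio S S' j = 5 / 4 := by
  obtain ⟨k, rfl⟩ := Nat.exists_eq_add_of_le hm
  -- Length `5` is the least for which the additional servers do not attract the jobs of length `5`
  -- on the server of workload `10`.
  refine ⟨6 + k, sixJobs.pad k 5 (by norm_num), padAssignment sixJobsBefore k, ?_, _, _,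
    pad_isDeviation k sixJobs_isDeviation, ?_⟩
  · refine pad_isNash _ _ _ sixJobs_isNash fun j => ?_
    rw [sixJobs_workload_before]
    fin_cases j <;> simp [sixJobs, sixJobsBefore] <;> norm_num
  · intro j hj
    obtain ⟨j, hjΓ, rfl⟩ := Finset.mem_map.1 hj
    exact (pad_improvementRatio _ _ _ _ _ j).trans (sixJobs_improvementRatio j hjΓ)

end LoadBalancingGame

theorem mainTheorem1 :
    -- every Nash equilibrium is a 5/4-approximate strong Nash equilibrium
    (∀ (m : ℕ), 3 ≤ m → ∀ (n : ℕ) (G : LoadBalancingGame n) (S : Fin n → Fin m),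
      G.IsNash S → G.IsApproxStrongNash (5 / 4) S) ∧
    -- for every number of servers, 5/4 is attained and is the best constant
    (∀ (m : ℕ), 3 ≤ m → ∃ (n : ℕ) (G : LoadBalancingGame n) (S : Fin n → Fin m),
      G.IsNash S ∧
      (∃ (Γ : Finset (Fin n)) (S' : Fin n → Fin m),
        LoadBalancingGame.IsDeviation S Γ S' ∧ ∀ j ∈ Γ, G.improvementRatio S S' j = 5 / 4) ∧
      ∀ ρ : ℝ, 1 ≤ ρ → ρ < 5 / 4 → ¬ G.IsApproxStrongNash ρ S) ∧
    -- the example with six jobs on three servers attains 5/4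
    (LoadBalancingGame.sixJobs.IsNash LoadBalancingGame.sixJobsBefore ∧
      LoadBalancingGame.IsDeviation LoadBalancingGame.sixJobsBefore
        LoadBalancingGame.sixJobsCoalition LoadBalancingGame.sixJobsAfter ∧
      (∀ j ∈ LoadBalancingGame.sixJobsCoalition,
        LoadBalancingGame.sixJobs.improvementRatio LoadBalancingGame.sixJobsBefore
          LoadBalancingGame.sixJobsAfter j = 5 / 4) ∧
      ∀ ρ : ℝ, 1 ≤ ρ → ρ < 5 / 4 →
        ¬ LoadBalancingGame.sixJobs.IsApproxStrongNash ρ LoadBalancingGame.sixJobsBefore) := by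
  refine ⟨fun m _ n G S hS => hS.isApproxStrongNash, fun m hm => ?_,
    LoadBalancingGame.sixJobs_isNash, LoadBalancingGame.sixJobs_isDeviation,
    LoadBalancingGame.sixJobs_improvementRatio, fun ρ _ hρ =>
      LoadBalancingGame.not_isApproxStrongNash_of_deviation
        LoadBalancingGame.sixJobs_isDeviation LoadBalancingGame.sixJobs_improvementRatio hρ⟩
  obtain ⟨n, G, S, hS, Γ, S', hd, hr⟩ :=
    LoadBalancingGame.exists_isNash_improvementRatio_eq hm
  exact ⟨n, G, S, hS, ⟨Γ, S', hd, hr⟩, fun ρ _ hρ =>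
    LoadBalancingGame.not_isApproxStrongNash_of_deviation hd hr hρ⟩
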